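/- Let $\mathcal P=(\mathbf x,\mathbf r)$ be a group presentation, where $\mathbf r$ is a subset of the free group $F$ on $\mathbf x$. Let $Y\cup Y^{-1}$ be the set of formal symbols $({}^{u}r)^{\varepsilon}$ with $u\in F$, $r\in\mathbf r$, $\varepsilon=\pm1$; put $\theta(({}^{u}r)^{\varepsilon})=ur^{\varepsilon}u^{-1}$, ${}^{w}(({}^{u}r)^{\varepsilon})=({}^{wu}r)^{\varepsilon}$ for $w\in F$, and $(({}^{u}r)^{\varepsilon})^{-1}=({}^{u}r)^{-\varepsilon}$. A $Y$-sequence is a finite sequence $(a_1,\dots,a_n)$ of elements of $Y\cup Y^{-1}$; it is an identity $Y$-sequence if $\theta(a_1)\cdots\theta(a_n)=1$ in $F$. Peiffer equivalence is the equivalence relation on $Y$-sequences generated by replacing an adjacent pair $(a,b)$ by $({}^{\theta(a)}b,a)$ or by $(b,{}^{\theta(b)^{-1}}a)$, and by deleting an adjacent pair $(a,a^{-1})$. The presentation $\mathcal P$ is called aspherical if every identity $Y$-sequence is Peiffer equivalent to the empty sequence (by a classical theorem this means that $\pi_2$ of the geometric realisation of $\mathcal P$ vanishes). Let $\Upsilon$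 be the monoid generated by $Y\cup Y^{-1}$ subject to the relations $ab={}^{\theta(a)}b\,a$ ($a,b\in Y\cup Y^{-1}$), let $\sigma$ be the canonical map from words over $Y\cup Y^{-1}$ to $\Upsilon$, let $\mathcal G(\Upsilon)$ be the universal enveloping group of $\Upsilon$ (the group with the same generators and relations), and let $\mu:\Upsilon\to\mathcal G(\Upsilon)$ be the canonical homomorphism. The map $\theta$ induces a homomorphism $\tilde\theta:\mathcal G(\Upsilon)\to F$, and $F$ acts on $\mathcal G(\Upsilon)$ by ${}^{w}\mu\sigma(a)=\mu\sigma({}^{w}a)$. Put $\tilde\Pi=\operatorname{Ker}\tilde\theta$, an abelian group which is stable under the action of $F$. Fix $r_0\in\mathbf r$, let $\mathcal P_1=(\mathbf x,\mathbf r\setminus\{r_0\})$, and denote by a subscript $1$ the objects formed in the same way from $\mathcal P_1$. Let $\hat f:\mathcal G(\Upsilon_1)\to\mathcal G(\Upsilon)$ be the homomorphism induced by the homomorphism $f:\Upsilon_1\to\Upsilon$, $\sigma_1(a)\mapsto\sigma(a)$. Let $\hat{\mathfrak A}_1$ be the subgroup of $\mathcal G(\Upsilon)$ generated by all $\mu\sigma(bb^{-1})$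 with $b\in Y_1\cup Y_1^{-1}$. Let $N_0$ be the normal closure of $r_0$ in $F$, and let $[\tilde\Pi_1,N_0]$ be the subgroup of $\tilde\Pi_1$ generated by all elements $d^{-1}\cdot{}^{n}d$ with $d\in\tilde\Pi_1$, $n\in N_0$. **Proposition.** If $\mathcal P$ is aspherical, then $\hat f$ maps $\tilde\Pi_1$ onto $\hat{\mathfrak A}_1$, that is, $\hat f(\tilde\Pi_1)=\hat{\mathfrak A}_1$, and $\hat f$ induces an epimorphism $\tilde\Pi_1/[\tilde\Pi_1,N_0]\to\hat{\mathfrak A}_1$, $d\,[\tilde\Pi_1,N_0]\mapsto\hat f(d)$. -/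

import Mathlib

/-! ### Universal enveloping groups of presented monoids -/

section EnvelopingGroup

variable {A : Type*}

/-- The universal enveloping group `𝒢(S)` of the monoid `S = ⟨A ∣ rels⟩`: the group with the same
generators, and with one relator `u v⁻¹` for every defining relation `u = v` of `S`. -/
def EnvelopingGroup (rels : FreeMonoid A → FreeMonoid A → Prop) : Type _ :=
  PresentedGroup {w : FreeGroup A | ∃ u v : FreeMonoid A, rels u v ∧
    w = FreeMonoid.lift FreeGroup.of u * (FreeMonoid.lift FreeGroup.of v)⁻¹}

namespace EnvelopingGroup

variable {rels : FreeMonoid A → FreeMonoid A → Prop}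

instance : Group (EnvelopingGroup rels) := inferInstanceAs (Group (PresentedGroup _))

variable (rels) in
/-- The canonical map from words to the enveloping group. -/
def wordMap : FreeMonoid A →* EnvelopingGroup rels :=
  (PresentedGroup.mk _).comp (FreeMonoid.lift FreeGroup.of)

variable (rels) in
/-- The canonical homomorphism `μ : S → 𝒢(S)`. -/
def mu : PresentedMonoid rels →* EnvelopingGroup rels :=
  PresentedMonoid.lift (fun a => wordMap rels (FreeMonoid.of a)) (by
    intro u v h
    have key : ∀ w : FreeMonoid A,
        FreeMonoid.lift (fun a => wordMap rels (FreeMonoid.of a)) w = wordMap rels w := by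
      intro w
      exact DFunLike.congr_fun (FreeMonoid.lift_restrict (wordMap rels)) w
    rw [key, key]
    exact PresentedGroup.mk_eq_mk_of_mul_inv_mem ⟨u, v, h, rfl⟩)

/-- The universal property of `μ : S → 𝒢(S)`: a monoid homomorphism `g : S → G` to a group induces
a group homomorphism `ĝ : 𝒢(S) → G` with `ĝ ∘ μ = g`. -/
def lift {G : Type*} [Group G] (g : PresentedMonoid rels →* G) : EnvelopingGroup rels →* G :=
  PresentedGroup.toGroup (f := fun a => g (PresentedMonoid.of rels a)) (by
    rintro w ⟨u, v, h, rfl⟩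
    have key : ∀ w : FreeMonoid A,
        FreeGroup.lift (fun a => g (PresentedMonoid.of rels a))
          (FreeMonoid.lift FreeGroup.of w) = g (PresentedMonoid.mk rels w) := by
      intro w
      have h2 : (FreeGroup.lift (fun a => g (PresentedMonoid.of rels a)) :
            FreeGroup A →* G).comp (FreeMonoid.lift FreeGroup.of)
          = g.comp (PresentedMonoid.mk rels) := by
        ext a; simp [PresentedMonoid.of]
      exact DFunLike.congr_fun h2 w
    rw [map_mul, map_inv, key, key, PresentedMonoid.mk_eq_mk_of_rel h, mul_inv_cancel])

theorem lift_mu {G : Type*} [Group G] (g : PresentedMonoid rels →* G) (s : PresentedMonoid rels) :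
    lift g (mu rels s) = g s := by
  have : (lift g).comp (mu rels) = g := by
    ext a
    simp only [MonoidHom.comp_apply]
    exact FreeGroup.lift_apply_of
  exact DFunLike.congr_fun this s

theorem hom_ext {G : Type*} [Group G] {g h : EnvelopingGroup rels →* G}
    (H : ∀ a, g (mu rels (PresentedMonoid.of rels a)) = h (mu rels (PresentedMonoid.of rels a))) :
    g = h :=
  PresentedGroup.ext H

end EnvelopingGroup

end EnvelopingGroup

/-! ### `Y`-sequences and asphericity of a group presentation `(X, R)`, with `R ⊆ FreeGroup X` -/

namespace GroupPresentation

variable {X : Type*}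

/-- An element `(ᵘr)^ε` of `Y ∪ Y⁻¹`: a formal symbol with `u` in the free group on `X`,
`r ∈ R` and `ε = ±1`. -/
structure Letter (R : Set (FreeGroup X)) where
  /-- the conjugator `u` -/
  conj : FreeGroup X
  /-- the relator `r` -/
  rel : R
  /-- the exponent `ε` -/
  sign : ℤˣ

namespace Letter

variable {R : Set (FreeGroup X)}

/-- The formal inverse `(ᵘr)^(-ε)` of `(ᵘr)^ε`. -/
def inv (a : Letter R) : Letter R := ⟨a.conj, a.rel, -a.sign⟩

/-- The action `ʷ((ᵘr)^ε) = (ʷᵘr)^ε` of the free group on letters. -/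
instance : MulAction (FreeGroup X) (Letter R) where
  smul w a := ⟨w * a.conj, a.rel, a.sign⟩
  one_smul a := by
    change (⟨1 * a.conj, a.rel, a.sign⟩ : Letter R) = a
    rw [one_mul]
  mul_smul v w a := by
    change (⟨v * w * a.conj, a.rel, a.sign⟩ : Letter R) = ⟨v * (w * a.conj), a.rel, a.sign⟩
    rw [mul_assoc]

/-- `θ((ᵘr)^ε) = u r^ε u⁻¹`. -/
def theta (a : Letter R) : FreeGroup X :=
  a.conj * (a.rel : FreeGroup X) ^ (a.sign : ℤ) * a.conj⁻¹

theorem theta_smul (w : FreeGroup X) (a : Letter R) : (w • a).theta = w * a.theta * w⁻¹ := by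
  change w * a.conj * (a.rel : FreeGroup X) ^ (a.sign : ℤ) * (w * a.conj)⁻¹ = _
  simp only [theta, mul_inv_rev, mul_assoc]

theorem theta_inv (a : Letter R) : a.inv.theta = a.theta⁻¹ := by
  simp [theta, inv, mul_assoc]

/-- The inclusion of letters coming from an inclusion of sets of relators. -/
def incl {R₁ R : Set (FreeGroup X)} (h : R₁ ⊆ R) (a : Letter R₁) : Letter R :=
  ⟨a.conj, ⟨a.rel, h a.rel.2⟩, a.sign⟩

end Letter

/-- The elementary Peiffer operations on `Y`-sequences: the two forms of the Peiffer exchange, and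
the Peiffer deletion. -/
inductive PeifferStep {R : Set (FreeGroup X)} : List (Letter R) → List (Letter R) → Prop
  | exchange_left (s t : List (Letter R)) (a b : Letter R) :
      PeifferStep (s ++ [a, b] ++ t) (s ++ [a.theta • b, a] ++ t)
  | exchange_right (s t : List (Letter R)) (a b : Letter R) :
      PeifferStep (s ++ [a, b] ++ t) (s ++ [b, b.theta⁻¹ • a] ++ t)
  | deletion (s t : List (Letter R)) (a : Letter R) :
      PeifferStep (s ++ [a, a.inv] ++ t) (s ++ t)

/-- Peiffer equivalence: the equivalence relation generated by Peiffer exchanges, deletions and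
insertions. -/
def PeifferEquiv {R : Set (FreeGroup X)} : List (Letter R) → List (Letter R) → Prop :=
  Relation.EqvGen PeifferStep

/-- An identity `Y`-sequence: a `Y`-sequence `(a₁, …, aₙ)` with `θ(a₁) ⋯ θ(aₙ) = 1`. -/
def IsIdentitySequence {R : Set (FreeGroup X)} (d : List (Letter R)) : Prop :=
  (d.map Letter.theta).prod = 1

/-- The presentation `(X, R)` is aspherical: every identity `Y`-sequence is Peiffer equivalent to
the empty sequence. -/
def Aspherical (R : Set (FreeGroup X)) : Prop :=
  ∀ d : List (Letter R), IsIdentitySequence d → PeifferEquiv d []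

/-! ### The monoid `Υ` and the group `𝒢(Υ)` -/

/-- The defining relations `a b = ᶿ⁽ᵃ⁾b a` of `Υ`, for `a, b ∈ Y ∪ Y⁻¹`. -/
inductive PeifferRel (R : Set (FreeGroup X)) :
    FreeMonoid (Letter R) → FreeMonoid (Letter R) → Prop
  | mk (a b : Letter R) :
      PeifferRel R (FreeMonoid.of a * FreeMonoid.of b)
        (FreeMonoid.of (a.theta • b) * FreeMonoid.of a)

/-- The monoid `Υ` with generators `Y ∪ Y⁻¹` and relations `a b = ᶿ⁽ᵃ⁾b a`. -/
abbrev Upsilon (R : Set (FreeGroup X)) : Type _ := PresentedMonoid (PeifferRel R)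

/-- The canonical image `σ(a)` of a letter in `Υ`. -/
abbrev sigma {R : Set (FreeGroup X)} (a : Letter R) : Upsilon R :=
  PresentedMonoid.of (PeifferRel R) a

/-- The universal enveloping group `𝒢(Υ)`. -/
abbrev GUpsilon (R : Set (FreeGroup X)) : Type _ := EnvelopingGroup (PeifferRel R)

/-- The canonical homomorphism `μ : Υ → 𝒢(Υ)`. -/
abbrev mu (R : Set (FreeGroup X)) : Upsilon R →* GUpsilon R := EnvelopingGroup.mu (PeifferRel R)

theorem sigma_mul_sigma {R : Set (FreeGroup X)} (a b : Letter R) :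
    sigma a * sigma b = sigma (a.theta • b) * sigma a :=
  PresentedMonoid.mk_eq_mk_of_rel (PeifferRel.mk a b)

/-- The homomorphism out of `Υ` given by a map on letters compatible with the relations. -/
def Upsilon.lift {R : Set (FreeGroup X)} {M : Type*} [Monoid M] (φ : Letter R → M)
    (h : ∀ a b, φ a * φ b = φ (a.theta • b) * φ a) : Upsilon R →* M :=
  PresentedMonoid.lift φ (by
    rintro _ _ ⟨a, b⟩
    simpa using h a b)

/-- The homomorphism `θ̃ : 𝒢(Υ) → F`, `μσ((ᵘr)^ε) ↦ u r^ε u⁻¹`. -/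
def thetaTilde (R : Set (FreeGroup X)) : GUpsilon R →* FreeGroup X :=
  EnvelopingGroup.lift (Upsilon.lift Letter.theta (by
    intro a b
    rw [Letter.theta_smul, inv_mul_cancel_right]))

theorem thetaTilde_mu_sigma {R : Set (FreeGroup X)} (a : Letter R) :
    thetaTilde R (mu R (sigma a)) = a.theta :=
  EnvelopingGroup.lift_mu _ _

/-- The action of a free group element `w` on `𝒢(Υ)`, `μσ((ᵘr)^ε) ↦ μσ((ʷᵘr)^ε)`. -/
def actHom (R : Set (FreeGroup X)) (w : FreeGroup X) : GUpsilon R →* GUpsilon R :=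
  EnvelopingGroup.lift (Upsilon.lift (fun a => mu R (sigma (w • a))) (by
    intro a b
    rw [← map_mul, ← map_mul, sigma_mul_sigma, Letter.theta_smul, smul_smul, smul_smul,
      inv_mul_cancel_right]))

theorem actHom_mu_sigma {R : Set (FreeGroup X)} (w : FreeGroup X) (a : Letter R) :
    actHom R w (mu R (sigma a)) = mu R (sigma (w • a)) :=
  EnvelopingGroup.lift_mu _ _

/-- The action of the free group `F` on `𝒢(Υ)` by group automorphisms. -/
instance (R : Set (FreeGroup X)) : MulDistribMulAction (FreeGroup X) (GUpsilon R) where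
  smul w g := actHom R w g
  one_smul g := by
    have h : actHom R 1 = MonoidHom.id _ := by
      apply EnvelopingGroup.hom_ext
      intro a
      exact (actHom_mu_sigma 1 a).trans (by rw [one_smul]; rfl)
    exact DFunLike.congr_fun h g
  mul_smul v w g := by
    have h : actHom R (v * w) = (actHom R v).comp (actHom R w) := by
      apply EnvelopingGroup.hom_ext
      intro a
      refine (actHom_mu_sigma (v * w) a).trans ?_
      refine Eq.trans ?_ (congrArg (actHom R v) (actHom_mu_sigma w a).symm)
      rw [mul_smul]
      exact (actHom_mu_sigma v (w • a)).symm
    exact DFunLike.congr_fun h g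
  smul_one w := map_one (actHom R w)
  smul_mul w := map_mul (actHom R w)

theorem smul_mu_sigma {R : Set (FreeGroup X)} (w : FreeGroup X) (a : Letter R) :
    w • mu R (sigma a) = mu R (sigma (w • a)) :=
  actHom_mu_sigma w a

theorem thetaTilde_smul {R : Set (FreeGroup X)} (w : FreeGroup X) (g : GUpsilon R) :
    thetaTilde R (w • g) = w * thetaTilde R g * w⁻¹ := by
  have h : (thetaTilde R).comp (actHom R w)
      = ((MulAut.conj w).toMonoidHom).comp (thetaTilde R) := by
    apply EnvelopingGroup.hom_ext
    intro a
    refine (congrArg (thetaTilde R) (actHom_mu_sigma w a)).trans ?_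
    refine (thetaTilde_mu_sigma _).trans ?_
    rw [Letter.theta_smul]
    exact congrArg (fun t => w * t * w⁻¹) (thetaTilde_mu_sigma a).symm
  exact DFunLike.congr_fun h g

/-- The Peiffer identity in the crossed module `(𝒢(Υ), F, θ̃)`. -/
theorem peiffer_identity {R : Set (FreeGroup X)} (g h : GUpsilon R) :
    g * h * g⁻¹ = thetaTilde R g • h := by
  have H : (MulAut.conj : GUpsilon R →* MulAut (GUpsilon R))
      = (MulDistribMulAction.toMulAut (FreeGroup X) (GUpsilon R)).comp (thetaTilde R) := by
    apply EnvelopingGroup.hom_ext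
    intro a
    apply MulEquiv.toMonoidHom_injective
    apply EnvelopingGroup.hom_ext
    intro b
    change mu R (sigma a) * mu R (sigma b) * (mu R (sigma a))⁻¹
      = thetaTilde R (mu R (sigma a)) • mu R (sigma b)
    rw [thetaTilde_mu_sigma, smul_mu_sigma, ← map_mul, sigma_mul_sigma, map_mul,
      mul_inv_cancel_right]
  exact DFunLike.congr_fun (DFunLike.congr_fun H g) h

/-! ### The generalized module of identities and the displacement subgroup -/

/-- The generalized module of identities `Π̃ = Ker θ̃`. -/
def genIdentities (R : Set (FreeGroup X)) : Subgroup (GUpsilon R) := (thetaTilde R).ker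

theorem genIdentities_central {R : Set (FreeGroup X)} {d : GUpsilon R}
    (hd : d ∈ genIdentities R) (g : GUpsilon R) : d * g = g * d := by
  have h := peiffer_identity d g
  rw [show thetaTilde R d = 1 from hd, one_smul] at h
  exact mul_inv_eq_iff_eq_mul.mp h

/-- `Π̃` is abelian. -/
instance (R : Set (FreeGroup X)) : CommGroup (genIdentities R) where
  __ := (inferInstance : Group (genIdentities R))
  mul_comm d e := Subtype.ext (genIdentities_central d.2 (e : GUpsilon R))

/-- The action of the free group `F` on `Π̃`, the restriction of its action on `𝒢(Υ)`. -/
instance (R : Set (FreeGroup X)) : MulDistribMulAction (FreeGroup X) (genIdentities R) where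
  smul w d := ⟨w • (d : GUpsilon R), by
    change thetaTilde R (w • (d : GUpsilon R)) = 1
    rw [thetaTilde_smul, show thetaTilde R (d : GUpsilon R) = 1 from d.2, mul_one,
      mul_inv_cancel]⟩
  one_smul d := Subtype.ext (one_smul _ (d : GUpsilon R))
  mul_smul v w d := Subtype.ext (mul_smul v w (d : GUpsilon R))
  smul_one w := Subtype.ext (map_one (actHom R w))
  smul_mul w d e := Subtype.ext (smul_mul' w (d : GUpsilon R) (e : GUpsilon R))

/-- The displacement subgroup `[Π̃, N]`: the subgroup of `Π̃` generated by the elements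
`d⁻¹ · ⁿd` with `d ∈ Π̃` and `n ∈ N`. -/
def displacement (R : Set (FreeGroup X)) (N : Subgroup (FreeGroup X)) :
    Subgroup (genIdentities R) :=
  Subgroup.closure {m | ∃ d : genIdentities R, ∃ n ∈ N, m = d⁻¹ * n • d}

/-! ### Subpresentations -/

section Sub

variable {R₁ R : Set (FreeGroup X)}

/-- The homomorphism `f : Υ₁ → Υ`, `σ₁(a) ↦ σ(a)`. -/
def fHom (h : R₁ ⊆ R) : Upsilon R₁ →* Upsilon R :=
  Upsilon.lift (fun a => sigma (a.incl h)) (fun a b => sigma_mul_sigma (a.incl h) (b.incl h))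

/-- The homomorphism `f̂ : 𝒢(Υ₁) → 𝒢(Υ)` induced by `f`; it satisfies `f̂ ∘ μ₁ = μ ∘ f`. -/
def fHat (h : R₁ ⊆ R) : GUpsilon R₁ →* GUpsilon R :=
  EnvelopingGroup.lift ((mu R).comp (fHom h))

/-- The subgroup `𝔄̂₁` of `𝒢(Υ)` generated by the elements `μσ(b b⁻¹)` with `b ∈ Y₁ ∪ Y₁⁻¹`. -/
def AHat (h : R₁ ⊆ R) : Subgroup (GUpsilon R) :=
  Subgroup.closure
    (Set.range fun b : Letter R₁ => mu R (sigma (b.incl h) * sigma (b.incl h).inv))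

end Sub

end GroupPresentation

/-!
Adjoining the symbols `a⁻¹` as actual inverses, i.e. killing all `μσ(a a⁻¹)`, turns `𝒢(Υ)` into
the group of `Y`-sequences modulo Peiffer equivalence. Asphericity says that this quotient embeds
into `F`, so every element of `Π̃`, in particular every `f̂(d)` with `d ∈ Π̃₁`, is a product of
elements `μσ(a a⁻¹)^{±1}`, where `a` may still involve relators outside `R₁`. Those are removed by a
retraction `𝒢(Υ) → Π̃` onto such products: the map `a ↦ μσ(a a⁻¹)` for `a ∈ Y` and `a ↦ 1` for
`a ∈ Y⁻¹` respects the relations `a b = ᶿ⁽ᵃ⁾b a` because `θ̃(𝒢(Υ))` acts trivially on `Π̃`, it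
fixes each `μσ(a a⁻¹)`, and it sends the image of `f̂` into `𝔄̂₁`. The triviality of the same action
gives `f̂(ⁿd) = ⁿf̂(d) = f̂(d)` for `n` in the normal closure of `R`.
-/

theorem exists_surjective_quotient_hom_map {G H : Type*} [Group G] [Group H] (f : G →* H)
    (A : Subgroup G) (D : Subgroup A) [D.Normal] (hD : D ≤ (f.comp A.subtype).ker) :
    ∃ φ : A ⧸ D →* A.map f, (∀ d : A, (φ (QuotientGroup.mk d) : H) = f d) ∧
      Function.Surjective φ :=
  have le_ker : D ≤ (f.subgroupMap A).ker := fun _ hd => Subtype.ext (hD hd)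
  ⟨QuotientGroup.lift D (f.subgroupMap A) le_ker, fun _ => rfl,
    QuotientGroup.lift_surjective_of_surjective D _ (f.subgroupMap_surjective A) le_ker⟩

namespace EnvelopingGroup

variable {A : Type*} {rels : FreeMonoid A → FreeMonoid A → Prop}

theorem closure_range_mu_of :
    Subgroup.closure (Set.range fun a => mu rels (PresentedMonoid.of rels a)) = ⊤ :=
  PresentedGroup.closure_range_of _

theorem range_le_iff {G : Type*} [Group G] {f : EnvelopingGroup rels →* G} {K : Subgroup G} :
    f.range ≤ K ↔ ∀ a, f (mu rels (PresentedMonoid.of rels a)) ∈ K := by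
  rw [MonoidHom.range_eq_map, ← closure_range_mu_of, Subgroup.map_le_iff_le_comap,
    Subgroup.closure_le, Set.range_subset_iff]
  rfl

end EnvelopingGroup

namespace GroupPresentation

variable {X : Type*} {R₁ R : Set (FreeGroup X)}

/-! ### The action of the relators on `Π̃` -/

theorem range_thetaTilde : (thetaTilde R).range = Subgroup.normalClosure R := by
  apply le_antisymm
  · refine EnvelopingGroup.range_le_iff.2 fun a => ?_
    rw [thetaTilde_mu_sigma]
    exact Subgroup.normalClosure_normal.conj_mem _
      (zpow_mem (Subgroup.subset_normalClosure a.rel.2) _) _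
  · have : (thetaTilde R).range.Normal := ⟨by
      rintro _ ⟨g, rfl⟩ w
      exact ⟨w • g, thetaTilde_smul w g⟩⟩
    refine Subgroup.normalClosure_le_normal fun r hr => ⟨mu R (sigma ⟨1, ⟨r, hr⟩, 1⟩), ?_⟩
    simp [thetaTilde_mu_sigma, Letter.theta]

theorem smul_eq_self_of_mem_normalClosure {w : FreeGroup X} (hw : w ∈ Subgroup.normalClosure R)
    (d : genIdentities R) : w • d = d := by
  rw [← range_thetaTilde] at hw
  obtain ⟨g, rfl⟩ := hw
  apply Subtype.ext
  change thetaTilde R g • (d : GUpsilon R) = d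
  rw [← peiffer_identity, ← genIdentities_central d.2, mul_inv_cancel_right]

namespace Letter

theorem inv_inv (a : Letter R) : a.inv.inv = a := by
  cases a
  simp only [inv, neg_neg]

theorem theta_mem_normalClosure (a : Letter R) : a.theta ∈ Subgroup.normalClosure R :=
  range_thetaTilde (R := R) ▸ ⟨_, thetaTilde_mu_sigma a⟩

/-- The element `μσ(a a⁻¹)`, regarded as an element of `Π̃`; it need not be trivial, because `a⁻¹`
is only a formal inverse. -/
def inversePair (a : Letter R) : genIdentities R :=
  ⟨mu R (sigma a * sigma a.inv), by
    rw [genIdentities, MonoidHom.mem_ker, map_mul, map_mul, thetaTilde_mu_sigma,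
      thetaTilde_mu_sigma, theta_inv, mul_inv_cancel]⟩

theorem coe_inversePair (a : Letter R) :
    (a.inversePair : GUpsilon R) = mu R (sigma a) * mu R (sigma a.inv) :=
  map_mul _ _ _

theorem inversePair_inv (a : Letter R) : a.inv.inversePair = a.inversePair := by
  have central := genIdentities_central a.inversePair.2 (mu R (sigma a))
  rw [coe_inversePair, mul_assoc] at central
  apply Subtype.ext
  rw [coe_inversePair, coe_inversePair, inv_inv]
  exact mul_left_cancel central

theorem inversePair_smul (w : FreeGroup X) (a : Letter R) :
    (w • a).inversePair = w • a.inversePair := by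
  apply Subtype.ext
  change _ = w • (a.inversePair : GUpsilon R)
  rw [coe_inversePair, coe_inversePair, smul_mul', smul_mu_sigma, smul_mu_sigma]
  rfl

end Letter

/-- The homomorphism `𝒢(Υ) → Π̃` sending `μσ(a)` to `μσ(a a⁻¹)` for `a ∈ Y` and to `1` for
`a ∈ Y⁻¹`. It retracts `𝒢(Υ)` onto the subgroup generated by the elements `μσ(a a⁻¹)`. -/
def pairRetraction (R : Set (FreeGroup X)) : GUpsilon R →* genIdentities R :=
  EnvelopingGroup.lift (Upsilon.lift (fun a => if a.sign = 1 then a.inversePair else 1) (by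
    intro a b
    rw [Letter.inversePair_smul, smul_eq_self_of_mem_normalClosure a.theta_mem_normalClosure]
    exact mul_comm _ _))

theorem pairRetraction_mu_sigma (a : Letter R) :
    pairRetraction R (mu R (sigma a)) = if a.sign = 1 then a.inversePair else 1 :=
  EnvelopingGroup.lift_mu _ _

theorem pairRetraction_inversePair (a : Letter R) :
    pairRetraction R (a.inversePair : GUpsilon R) = a.inversePair := by
  rw [Letter.coe_inversePair, map_mul, pairRetraction_mu_sigma, pairRetraction_mu_sigma,
    Letter.inversePair_inv]
  rcases Int.units_eq_one_or a.sign with h | h <;> simp [Letter.inv, h]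

/-! ### Subpresentations -/

section Subpresentation

variable (h : R₁ ⊆ R)

theorem inversePair_mem_AHat (a : Letter R₁) : ((a.incl h).inversePair : GUpsilon R) ∈ AHat h :=
  Subgroup.subset_closure ⟨a, rfl⟩

theorem AHat_le_genIdentities : AHat h ≤ genIdentities R := by
  rw [AHat, Subgroup.closure_le]
  rintro _ ⟨a, rfl⟩
  exact (a.incl h).inversePair.2

instance : (AHat h).Normal where
  conj_mem d hd g := by
    rwa [← genIdentities_central (AHat_le_genIdentities h hd), mul_inv_cancel_right]

theorem pairRetraction_of_mem_AHat {g : GUpsilon R} (hg : g ∈ AHat h) :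
    (pairRetraction R g : GUpsilon R) = g := by
  have le_eqLocus : AHat h ≤ ((genIdentities R).subtype.comp (pairRetraction R)).eqLocus
      (MonoidHom.id _) := by
    rw [AHat, Subgroup.closure_le]
    rintro _ ⟨a, rfl⟩
    exact congrArg Subtype.val (pairRetraction_inversePair (a.incl h))
  exact le_eqLocus hg

theorem fHat_mu_sigma (a : Letter R₁) :
    fHat h (mu R₁ (sigma a)) = mu R (sigma (a.incl h)) :=
  EnvelopingGroup.lift_mu _ _

theorem fHat_inversePair (a : Letter R₁) :
    fHat h (a.inversePair : GUpsilon R₁) = (a.incl h).inversePair := by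
  rw [Letter.coe_inversePair, Letter.coe_inversePair, map_mul, fHat_mu_sigma, fHat_mu_sigma]
  rfl

theorem thetaTilde_comp_fHat : (thetaTilde R).comp (fHat h) = thetaTilde R₁ := by
  refine EnvelopingGroup.hom_ext fun a => ?_
  rw [MonoidHom.comp_apply, fHat_mu_sigma, thetaTilde_mu_sigma, thetaTilde_mu_sigma]
  rfl

theorem fHat_mem_genIdentities {d : GUpsilon R₁} (hd : d ∈ genIdentities R₁) :
    fHat h d ∈ genIdentities R :=
  (DFunLike.congr_fun (thetaTilde_comp_fHat h) d).trans hd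

theorem fHat_smul (w : FreeGroup X) (g : GUpsilon R₁) : fHat h (w • g) = w • fHat h g := by
  have equivariant : (fHat h).comp (actHom R₁ w) = (actHom R w).comp (fHat h) := by
    refine EnvelopingGroup.hom_ext fun a => ?_
    rw [MonoidHom.comp_apply, MonoidHom.comp_apply, actHom_mu_sigma, fHat_mu_sigma,
      fHat_mu_sigma, actHom_mu_sigma]
    rfl
  exact DFunLike.congr_fun equivariant g

theorem pairRetraction_fHat_mem_AHat (g : GUpsilon R₁) :
    (pairRetraction R (fHat h g) : GUpsilon R) ∈ AHat h := by
  let retracted : GUpsilon R₁ →* GUpsilon R :=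
    (genIdentities R).subtype.comp ((pairRetraction R).comp (fHat h))
  have range_le : retracted.range ≤ AHat h := EnvelopingGroup.range_le_iff.2 fun a => by
    change (pairRetraction R (fHat h (mu R₁ (sigma a))) : GUpsilon R) ∈ AHat h
    rw [fHat_mu_sigma, pairRetraction_mu_sigma]
    split_ifs
    · exact inversePair_mem_AHat h a
    · exact one_mem _
  exact range_le ⟨g, rfl⟩

theorem AHat_le_map_fHat : AHat h ≤ (genIdentities R₁).map (fHat h) := by
  rw [AHat, Subgroup.closure_le]
  rintro _ ⟨a, rfl⟩
  exact ⟨a.inversePair, a.inversePair.2, fHat_inversePair h a⟩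

theorem displacement_le_ker {N : Subgroup (FreeGroup X)} (hN : N ≤ Subgroup.normalClosure R) :
    displacement R₁ N ≤ ((fHat h).comp (genIdentities R₁).subtype).ker := by
  rw [displacement, Subgroup.closure_le]
  rintro _ ⟨d, n, hn, rfl⟩
  have fixed : n • fHat h (d : GUpsilon R₁) = fHat h d := congrArg Subtype.val
    (smul_eq_self_of_mem_normalClosure (hN hn) ⟨_, fHat_mem_genIdentities h d.2⟩)
  change fHat h ((d : GUpsilon R₁)⁻¹ * n • (d : GUpsilon R₁)) = 1
  rw [map_mul, map_inv, fHat_smul, fixed, inv_mul_cancel]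

end Subpresentation

/-! ### Asphericity -/

section PeifferInvariants

variable {M : Type*} [Monoid M] {φ : Letter R → M}

theorem PeifferStep.prod_map_eq (exchange : ∀ a b, φ a * φ b = φ (a.theta • b) * φ a)
    (cancel : ∀ a, φ a * φ a.inv = 1) {l m : List (Letter R)} (hlm : PeifferStep l m) :
    (l.map φ).prod = (m.map φ).prod := by
  cases hlm with
  | exchange_left s t a b =>
    simp only [List.map_append, List.prod_append, List.map_cons, List.map_nil, List.prod_pair,
      exchange a b]
  | exchange_right s t a b =>
    simp only [List.map_append, List.prod_append, List.map_cons, List.map_nil, List.prod_pair,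
      exchange b (b.theta⁻¹ • a), smul_inv_smul]
  | deletion s t a =>
    simp only [List.map_append, List.prod_append, List.map_cons, List.map_nil, List.prod_pair,
      cancel a, mul_one]

theorem PeifferEquiv.prod_map_eq (exchange : ∀ a b, φ a * φ b = φ (a.theta • b) * φ a)
    (cancel : ∀ a, φ a * φ a.inv = 1) {l m : List (Letter R)} (hlm : PeifferEquiv l m) :
    (l.map φ).prod = (m.map φ).prod := by
  induction hlm with
  | rel _ _ step => exact step.prod_map_eq exchange cancel
  | refl => rfl
  | symm _ _ _ ih => exact ih.symm
  | trans _ _ _ _ _ ih₁ ih₂ => exact ih₁.trans ih₂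

end PeifferInvariants

/-- The quotient of `𝒢(Υ)` by the subgroup generated by the elements `μσ(a a⁻¹)`, that is, the
group of `Y`-sequences modulo Peiffer equivalence. -/
abbrev PeifferGroup (R : Set (FreeGroup X)) : Type _ := GUpsilon R ⧸ AHat (Set.Subset.refl R)

namespace PeifferGroup

/-- The class of a one-letter `Y`-sequence. -/
def of (a : Letter R) : PeifferGroup R := QuotientGroup.mk (mu R (sigma a))

/-- The homomorphism to `F` induced by `θ̃`. -/
def theta (R : Set (FreeGroup X)) : PeifferGroup R →* FreeGroup X :=
  QuotientGroup.lift _ (thetaTilde R) (AHat_le_genIdentities _)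

theorem theta_of (a : Letter R) : theta R (of a) = a.theta :=
  thetaTilde_mu_sigma a

theorem of_mul_of (a b : Letter R) : of a * of b = of (a.theta • b) * of a := by
  rw [of, of, of, ← QuotientGroup.mk_mul, ← QuotientGroup.mk_mul, ← map_mul, ← map_mul,
    sigma_mul_sigma]

theorem of_mul_of_inv (a : Letter R) : of a * of a.inv = 1 := by
  rw [of, of, ← QuotientGroup.mk_mul, ← Letter.coe_inversePair]
  exact (QuotientGroup.eq_one_iff _).2 (inversePair_mem_AHat _ a)

theorem exists_prod_map_of (g : GUpsilon R) : ∃ l : List (Letter R), (l.map of).prod = g := by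
  have hg : g ∈ Subgroup.closure (Set.range fun a : Letter R => mu R (sigma a)) :=
    EnvelopingGroup.closure_range_mu_of (rels := PeifferRel R) ▸ Subgroup.mem_top g
  induction hg using Subgroup.closure_induction'' with
  | one => exact ⟨[], rfl⟩
  | mem _ hx =>
    obtain ⟨a, rfl⟩ := hx
    exact ⟨[a], List.prod_singleton⟩
  | inv_mem _ hx =>
    obtain ⟨a, rfl⟩ := hx
    exact ⟨[a.inv], List.prod_singleton.trans (inv_eq_of_mul_eq_one_right (of_mul_of_inv a)).symm⟩
  | mul x y _ _ hx hy =>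
    obtain ⟨l, hl⟩ := hx
    obtain ⟨m, hm⟩ := hy
    exact ⟨l ++ m, by rw [List.map_append, List.prod_append, hl, hm, QuotientGroup.mk_mul]⟩

end PeifferGroup

theorem Aspherical.genIdentities_le_AHat (hR : Aspherical R) :
    genIdentities R ≤ AHat (Set.Subset.refl R) := by
  intro g hg
  obtain ⟨l, hl⟩ := PeifferGroup.exists_prod_map_of g
  have identity : IsIdentitySequence l := calc
    (l.map Letter.theta).prod = PeifferGroup.theta R (l.map PeifferGroup.of).prod := by
      rw [map_list_prod, List.map_map]
      exact congrArg List.prod (List.map_congr_left fun a _ => (PeifferGroup.theta_of a).symm)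
    _ = thetaTilde R g := by rw [hl]; rfl
    _ = 1 := hg
  rw [← QuotientGroup.eq_one_iff, ← hl]
  exact (hR l identity).prod_map_eq PeifferGroup.of_mul_of PeifferGroup.of_mul_of_inv

theorem Aspherical.map_fHat_genIdentities (hR : Aspherical R) (h : R₁ ⊆ R) :
    (genIdentities R₁).map (fHat h) = AHat h := by
  refine le_antisymm ?_ (AHat_le_map_fHat h)
  rintro _ ⟨d, hd, rfl⟩
  have fixed : (pairRetraction R (fHat h d) : GUpsilon R) = fHat h d :=
    pairRetraction_of_mem_AHat _ (hR.genIdentities_le_AHat (fHat_mem_genIdentities h hd))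
  exact fixed ▸ pairRetraction_fHat_mem_AHat h d

end GroupPresentation

open GroupPresentation in
theorem proposition5p2_general {X : Type*} {R₁ R : Set (FreeGroup X)} (h : R₁ ⊆ R)
    (hR : Aspherical R) {N : Subgroup (FreeGroup X)} (hN : N ≤ Subgroup.normalClosure R) :
    (genIdentities R₁).map (fHat h) = AHat h ∧
      ∃ φ : genIdentities R₁ ⧸ displacement R₁ N →* AHat h,
        (∀ d : genIdentities R₁, (φ (QuotientGroup.mk d) : GUpsilon R) = fHat h d) ∧
        Function.Surjective φ := by
  have map_eq := hR.map_fHat_genIdentities h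
  refine ⟨map_eq, ?_⟩
  rw [← map_eq]
  exact exists_surjective_quotient_hom_map (fHat h) (genIdentities R₁) (displacement R₁ N)
    (displacement_le_ker h hN)

open GroupPresentation in
theorem proposition5p2 {X : Type*} (R : Set (FreeGroup X)) (hR : Aspherical R)
    (r₀ : FreeGroup X) (hr₀ : r₀ ∈ R) :
    (genIdentities (R \ {r₀})).map (fHat (Set.sdiff_subset : R \ {r₀} ⊆ R)) =
        AHat (Set.sdiff_subset : R \ {r₀} ⊆ R) ∧
      ∃ φ : genIdentities (R \ {r₀}) ⧸ displacement (R \ {r₀}) (Subgroup.normalClosure {r₀}) →*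
          AHat (Set.sdiff_subset : R \ {r₀} ⊆ R),
        (∀ d : genIdentities (R \ {r₀}),
          (φ (QuotientGroup.mk d) : GUpsilon R) =
            fHat (Set.sdiff_subset : R \ {r₀} ⊆ R) (d : GUpsilon (R \ {r₀}))) ∧
        Function.Surjective φ :=
  proposition5p2_general Set.sdiff_subset hR
    (Subgroup.normalClosure_mono (Set.singleton_subset_iff.2 hr₀))
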